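/- Let $F:[1,\infty)\to\mathbb R$ be a non-decreasing continuous function such that the integral $$f(s) := \int_1^\infty F(u)u^{-s-1}\,du$$ converges for every complex $s$ with $\operatorname{Re} s>1$. Let $M\ge 0$ be an integer, let $\gamma_0,\dots,\gamma_M\in\mathbb C$ with $\gamma_M\neq 0$, and let $$P(s) = \gamma_M + \gamma_{M-1}(s-1) + \cdots + \gamma_0(s-1)^M .$$ Suppose that $f(s) - P(s)(s-1)^{-M-1}$ is holomorphic for $\operatorname{Re} s>1$ and extends to a continuous function on the closed half-plane $\operatorname{Re} s\ge 1$. Then $$F(x)\sim \frac{\gamma_M}{M!}\,x(\log x)^M\qquad(x\to\infty).$$ -/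

import Mathlib

open Asymptotics Filter MeasureTheory Set

namespace WienerIkehara

/-- The transform `f(s) = ∫_1^∞ F(u) u^{-s-1} du` of a real function `F`. -/
noncomputable def transform (F : ℝ → ℝ) (s : ℂ) : ℂ :=
  ∫ u in Ioi (1 : ℝ), (F u : ℂ) * (u : ℂ) ^ (-s - 1)

/-- The integral defining `transform F s` converges (absolutely; since a non-decreasing `F` has
eventually constant sign, this is the same as convergence for all `s` in a half-plane). -/
def TransformConverges (F : ℝ → ℝ) (s : ℂ) : Prop :=
  IntegrableOn (fun u : ℝ => (F u : ℂ) * (u : ℂ) ^ (-s - 1)) (Ioi 1)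

/-- `P(s) = γ_M + γ_{M-1} (s-1) + ⋯ + γ_0 (s-1)^M`. -/
noncomputable def polarPoly (M : ℕ) (γ : ℕ → ℂ) (s : ℂ) : ℂ :=
  ∑ j ∈ Finset.range (M + 1), γ j * (s - 1) ^ (M - j)

/-- `g` is holomorphic on `Re s > 1` and extends continuously to `Re s ≥ 1`; the values of `g`
itself on and to the left of the line `Re s = 1` play no role. -/
def HolomorphicContinuousUpToLine (g : ℂ → ℂ) : Prop :=
  DifferentiableOn ℂ g {s : ℂ | 1 < s.re} ∧
    ∃ G : ℂ → ℂ, ContinuousOn G {s : ℂ | 1 ≤ s.re} ∧ ∀ s : ℂ, 1 < s.re → G s = g s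

end WienerIkehara

/-! Put `u = e^x` and `b(x) = e^{-x} (F(e^x) - F(1))`. Then `b ≥ 0`, `b(x) e^x` is non-decreasing,
and the Laplace transform of `b` is `∑ γ_j / s^(j+1) + G(s)` with `G` continuous up to the imaginary
axis. The sum is the transform of a polynomial `A` with leading term `γ_M x^M / M!`, so the claim
becomes `b(y) ~ A(y)`.

Average against `K(l(x - y))`, where `K ≥ 0` is the Fourier transform of a compactly supported `φ`.
For `b - A`, damped by `e^{-εx}`, Fubini turns the average into an integral of `G` over a compact
segment of `Re s = ε`. As `ε → 0`, positivity of `b` permits monotone convergence and continuity of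
`G` controls the other side (`integral_mul_kernel_eq`). The integral of `G` on the boundary vanishes
as `y → ∞` by Riemann-Lebesgue, so the averages of `b` and `A` agree to order `y^M`
(`tendsto_integral_mul_kernel`).

Monotonicity of `b(x) e^x` removes the averaging: over a distance `2δ`, `b` cannot fall by more than
a factor `e^{-2δ}`. A kernel centred at `y + δ` thus bounds `b(y)` above; the resulting growth bound
controls the tails of a kernel centred at `y - δ`, which bounds `b(y)` below. -/

open scoped FourierTransform Topology Convolution

namespace WienerIkehara

/-! ### The smoothing kernel -/

/-- A continuous compactly supported function whose Fourier transform is non-negative, continuous,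
not identically zero, and has finite moments of all orders. -/
theorem exists_fourier_nonneg_kernel :
    ∃ (φ : ℝ → ℂ) (K : ℝ → ℝ), Continuous φ ∧ HasCompactSupport φ ∧
      (∀ v, (K v : ℂ) = 𝓕 φ v) ∧ (∀ v, 0 ≤ K v) ∧ Continuous K ∧
      (∀ n : ℕ, Integrable fun v => |v| ^ n * K v) ∧ 0 < ∫ v, K v := by
  let b : ContDiffBump (0 : ℝ) := ⟨1, 2, by norm_num, by norm_num⟩
  let ψ : ℝ → ℂ := fun x => (b x : ℂ)
  have hψs : HasCompactSupport ψ := b.hasCompactSupport.comp_left (g := Complex.ofReal) (by simp)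
  have hψc : ContDiff ℝ ((⊤ : ℕ∞) : WithTop ℕ∞) ψ := Complex.ofRealCLM.contDiff.comp b.contDiff
  let S : SchwartzMap ℝ ℂ := hψs.toSchwartzMap hψc
  have hS : (S : ℝ → ℂ) = ψ := by ext; rfl
  have hψi : Integrable ψ := hψc.continuous.integrable_of_hasCompactSupport hψs
  have hFS : ((𝓕 S : SchwartzMap ℝ ℂ) : ℝ → ℂ) = 𝓕 ψ := by
    rw [SchwartzMap.fourier_coe, hS]
  have hcont : Continuous (𝓕 ψ) := hFS ▸ (𝓕 S : SchwartzMap ℝ ℂ).continuous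
  -- The bump is real and even, so its transform is real; hence the transform of `ψ ⋆ ψ`, a square,
  -- equals `‖𝓕 ψ‖ ^ 2 ≥ 0`.
  have hreal : ∀ v, (starRingEnd ℂ) (𝓕 ψ v) = 𝓕 ψ v := by
    intro v
    rw [Real.fourier_real_eq_integral_exp_smul, ← integral_conj, ← integral_neg_eq_self]
    congr 1
    ext x
    have : ψ (-x) = ψ x := by simp only [ψ, b.neg]
    simp only [smul_eq_mul, map_mul, ← Complex.exp_conj, this, Complex.conj_ofReal,
      Complex.conj_I, ψ]
    congr 2
    push_cast
    ring
  obtain ⟨C, hC⟩ : ∃ C, ∀ v, ‖𝓕 ψ v‖ ≤ C := by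
    refine ⟨∫ x, ‖ψ x‖, fun v => ?_⟩
    exact VectorFourier.norm_fourierIntegral_le_integral_norm _ _ _ _ _
  have hKc : Continuous fun v => ‖𝓕 ψ v‖ ^ 2 := by fun_prop
  have hmom : ∀ n : ℕ, Integrable fun v => |v| ^ n * ‖𝓕 ψ v‖ ^ 2 := by
    intro n
    have h := ((𝓕 S : SchwartzMap ℝ ℂ).integrable_pow_mul volume n).const_mul C
    rw [hFS] at h
    refine h.mono' (by fun_prop) (ae_of_all _ fun v => ?_)
    have h1 := hC v
    have : 0 ≤ ‖v‖ ^ n * ‖𝓕 ψ v‖ := by positivity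
    rw [Real.norm_of_nonneg (by positivity), ← Real.norm_eq_abs]
    nlinarith
  refine ⟨ψ ⋆[ContinuousLinearMap.mul ℂ ℂ] ψ, fun v => ‖𝓕 ψ v‖ ^ 2, ?_, ?_, ?_, ?_, hKc, hmom, ?_⟩
  · exact hψs.continuous_convolution_right _ hψi.locallyIntegrable hψc.continuous
  · exact hψs.convolution _ hψs
  · intro v
    beta_reduce
    rw [Real.fourier_mul_convolution_eq hψi hψi, ← Complex.normSq_eq_norm_sq,
      Complex.normSq_eq_conj_mul_self, hreal]
  · intro v
    positivity
  · refine integral_pos_of_integrable_nonneg_nonzero (x := 0) hKc (by simpa using hmom 0)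
      (fun v => by positivity) ?_
    have : 𝓕 ψ 0 = ((∫ x, b x : ℝ) : ℂ) := by
      rw [Real.fourier_real_eq_integral_exp_smul, ← integral_complex_ofReal]
      simp [ψ]
    have hpos := b.integral_pos (μ := (volume : Measure ℝ))
    rw [this]
    simpa using hpos.ne'

/-! ### Laplace transforms of monomials -/

theorem integrableOn_pow_mul_cexp_neg (n : ℕ) {s : ℂ} (hs : 0 < s.re) :
    IntegrableOn (fun x : ℝ => (x : ℂ) ^ n * Complex.exp (-s * x)) (Ioi 0) := by
  have h := integrableOn_rpow_mul_exp_neg_mul_rpow (s := n) (p := 1) (b := s.re)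
    (by have : (0 : ℝ) ≤ n := n.cast_nonneg
        linarith) one_pos hs
  refine h.mono' (by fun_prop) ?_
  filter_upwards [ae_restrict_mem measurableSet_Ioi] with x hx
  have hx : 0 < x := hx
  simp [Complex.norm_exp, abs_of_pos hx]

theorem integral_pow_mul_cexp_neg (n : ℕ) {s : ℂ} (hs : 0 < s.re) :
    ∫ x in Ioi (0 : ℝ), (x : ℂ) ^ n * Complex.exp (-s * x) = n.factorial / s ^ (n + 1) := by
  have hs0 : s ≠ 0 := by
    rintro rfl
    simp at hs
  induction n with
  | zero =>
    have := integral_exp_mul_complex_Ioi (a := -s) (by simpa using hs) 0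
    simpa [neg_div_neg_eq] using this
  | succ n ih =>
    have hlim : Tendsto (fun x : ℝ => (x : ℂ) ^ (n + 1) * Complex.exp (-s * x)) atTop (𝓝 0) := by
      rw [tendsto_zero_iff_norm_tendsto_zero]
      refine (tendsto_rpow_mul_exp_neg_mul_atTop_nhds_zero (n + 1 : ℕ) s.re hs).congr' ?_
      filter_upwards [eventually_gt_atTop 0] with x hx
      rw [Real.rpow_natCast]
      simp [Complex.norm_exp, abs_of_pos hx]
    have hderiv : ∀ x ∈ Ici (0 : ℝ),
        HasDerivAt (fun x : ℝ => (x : ℂ) ^ (n + 1) * Complex.exp (-s * x))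
          ((n + 1) * ((x : ℂ) ^ n * Complex.exp (-s * x)) -
            s * ((x : ℂ) ^ (n + 1) * Complex.exp (-s * x))) x := by
      intro x _
      have h1 : HasDerivAt (fun x : ℂ => x ^ (n + 1) * Complex.exp (-s * x))
          ((n + 1) * ((x : ℂ) ^ n * Complex.exp (-s * x)) -
            s * ((x : ℂ) ^ (n + 1) * Complex.exp (-s * x))) x := by
        convert! (hasDerivAt_pow (n + 1) (x : ℂ)).mul
          ((hasDerivAt_const_mul (-s)).cexp) using 1
        push_cast
        simp
        ring
      exact h1.comp_ofReal
    have i1 := (integrableOn_pow_mul_cexp_neg n hs).const_mul ((n : ℂ) + 1)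
    have i2 := (integrableOn_pow_mul_cexp_neg (n + 1) hs).const_mul s
    have h := integral_Ioi_of_hasDerivAt_of_tendsto' hderiv (i1.sub i2) hlim
    rw [integral_sub i1 i2, integral_const_mul, integral_const_mul, ih] at h
    simp only [Complex.ofReal_zero, ne_eq, Nat.succ_ne_zero, not_false_eq_true, zero_pow,
      zero_mul, sub_zero] at h
    rw [sub_eq_zero] at h
    rw [← mul_right_inj' hs0, ← h, Nat.factorial_succ]
    push_cast
    field_simp
    ring

/-! ### Integrability tools -/

/-- Monotone convergence, with integrability of the limit deduced from convergence of the
integrals. -/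
theorem integrable_and_integral_eq_of_monotone_tendsto {μ : Measure ℝ} {f : ℕ → ℝ → ℝ}
    {g : ℝ → ℝ} {L : ℝ} (hf : ∀ n, Integrable (f n) μ) (h0 : ∀ n, 0 ≤ᵐ[μ] f n)
    (hmono : ∀ᵐ x ∂μ, Monotone fun n => f n x)
    (hlim : ∀ᵐ x ∂μ, Tendsto (fun n => f n x) atTop (𝓝 (g x)))
    (hL : Tendsto (fun n => ∫ x, f n x ∂μ) atTop (𝓝 L)) :
    Integrable g μ ∧ ∫ x, g x ∂μ = L := by
  have hg : Integrable g μ := by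
    refine integrable_of_tendsto hlim (fun n => (hf n).aestronglyMeasurable) ?_
    have h : ∀ n, ∫⁻ x, ‖f n x‖ₑ ∂μ = ENNReal.ofReal (∫ x, f n x ∂μ) := by
      intro n
      rw [ofReal_integral_eq_lintegral_ofReal (hf n) (h0 n)]
      refine lintegral_congr_ae ?_
      filter_upwards [h0 n] with x hx
      exact Real.enorm_of_nonneg hx
    simp_rw [h]
    rw [(ENNReal.tendsto_ofReal hL).liminf_eq]
    exact ENNReal.ofReal_ne_top
  exact ⟨hg, tendsto_nhds_unique (integral_tendsto_of_tendsto_of_monotone hf hg hmono hlim) hL⟩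

theorem integrable_add_mul_abs_pow_mul {K : ℝ → ℝ}
    (hK : ∀ n : ℕ, Integrable fun v => |v| ^ n * K v) (c d : ℝ) (n : ℕ) :
    Integrable fun v => (c + d * |v|) ^ n * K v := by
  simp_rw [add_pow, Finset.sum_mul]
  refine integrable_finsetSum _ fun m _ => ?_
  convert! (hK (n - m)).const_mul (c ^ m * d ^ (n - m) * n.choose m) using 2
  ring

theorem integrable_one_add_abs_pow_mul_comp {K : ℝ → ℝ} (hKc : Continuous K) (hK0 : ∀ v, 0 ≤ K v)
    (hK : ∀ n : ℕ, Integrable fun v => |v| ^ n * K v) {l : ℝ} (hl : 0 < l) (y : ℝ) (n : ℕ) :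
    Integrable fun x => (1 + |x|) ^ n * K (l * (x - y)) := by
  have h := ((integrable_add_mul_abs_pow_mul hK (1 + |y|) l⁻¹ n).comp_mul_left' hl.ne').comp_sub_right
    y
  -- Domination rests on `1 + |x| ≤ (1 + |y|) + l⁻¹ |l (x - y)|`.
  refine h.mono' (by fun_prop) (ae_of_all _ fun x => ?_)
  have hk := hK0 (l * (x - y))
  rw [Real.norm_of_nonneg (by positivity), abs_mul, abs_of_pos hl, inv_mul_cancel_left₀ hl.ne']
  refine mul_le_mul_of_nonneg_right (pow_le_pow_left₀ (by positivity) ?_ _) hk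
  have := abs_add_le y (x - y)
  rw [add_sub_cancel] at this
  linarith

/-! ### Kernel averages as integrals along vertical lines -/

/-- Write `K` as a Fourier integral and swap by Fubini: the damping `ε` makes the double integral
absolutely convergent, and the frequency `t` moves the Laplace variable to `ε + 2πlt i`. -/
theorem integral_mul_exp_mul_kernel {φ : ℝ → ℂ} {K : ℝ → ℝ} (hφ : Continuous φ)
    (hφs : HasCompactSupport φ) (hK : ∀ v, (K v : ℂ) = 𝓕 φ v) {D : ℝ → ℂ} {ε : ℝ} (l y : ℝ)
    (hD : IntegrableOn (fun x : ℝ => D x * Complex.exp (-(ε : ℂ) * x)) (Ioi 0)) :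
    ∫ x in Ioi (0 : ℝ), D x * Complex.exp (-(ε : ℂ) * x) * (K (l * (x - y)) : ℂ) =
      ∫ t : ℝ, φ t * Complex.exp (2 * Real.pi * l * y * t * Complex.I) *
        ∫ x in Ioi (0 : ℝ), D x *
          Complex.exp (-((ε : ℂ) + (2 * Real.pi * l * t : ℝ) * Complex.I) * x) := by
  have hφi : Integrable φ := hφ.integrable_of_hasCompactSupport hφs
  have hint : Integrable (Function.uncurry fun (x t : ℝ) =>
      D x * Complex.exp (-(ε : ℂ) * x) *
        (Complex.exp ((-2 * Real.pi * t * (l * (x - y)) : ℝ) * Complex.I) * φ t))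
      ((volume.restrict (Ioi 0)).prod volume) := by
    have h : Integrable (fun p : ℝ × ℝ => (D p.1 * Complex.exp (-(ε : ℂ) * p.1)) * φ p.2)
      ((volume.restrict (Ioi 0)).prod volume) := Integrable.mul_prod hD hφi
    have h2 := h.bdd_mul (c := 1) (f := fun p : ℝ × ℝ =>
      Complex.exp ((-2 * Real.pi * p.2 * (l * (p.1 - y)) : ℝ) * Complex.I))
      (Continuous.aestronglyMeasurable (by fun_prop))
      (ae_of_all _ fun p => (Complex.norm_exp_ofReal_mul_I _).le)
    convert! h2 using 1
    ext p
    simp only [Function.uncurry]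
    ring
  have h := integral_integral_swap hint
  calc _ = ∫ x in Ioi (0 : ℝ), ∫ t : ℝ, D x * Complex.exp (-(ε : ℂ) * x) *
        (Complex.exp ((-2 * Real.pi * t * (l * (x - y)) : ℝ) * Complex.I) * φ t) := by
        congr 1
        ext x
        rw [hK, Real.fourier_real_eq_integral_exp_smul, ← integral_const_mul]
        rfl
    _ = _ := by
        rw [h]
        congr 1
        ext t
        rw [← integral_const_mul]
        congr 1
        ext x
        have : Complex.exp (-(ε : ℂ) * x) *
            Complex.exp ((-2 * Real.pi * t * (l * (x - y)) : ℝ) * Complex.I) =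
            Complex.exp (2 * Real.pi * l * y * t * Complex.I) *
            Complex.exp (-((ε : ℂ) + (2 * Real.pi * l * t : ℝ) * Complex.I) * x) := by
          rw [← Complex.exp_add, ← Complex.exp_add]
          congr 1
          push_cast
          ring
        linear_combination (D x * φ t) * this

theorem tendsto_integral_mul_boundary {φ : ℝ → ℂ} (hφ : Continuous φ) (hφs : HasCompactSupport φ)
    {G : ℂ → ℂ} (hG : ContinuousOn G {s : ℂ | 0 ≤ s.re}) (l y : ℝ) :
    Tendsto (fun ε : ℝ => ∫ t : ℝ, φ t * Complex.exp (2 * Real.pi * l * y * t * Complex.I) *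
        G ((ε : ℂ) + (2 * Real.pi * l * t : ℝ) * Complex.I)) (𝓝[>] 0)
      (𝓝 (∫ t : ℝ, φ t * Complex.exp (2 * Real.pi * l * y * t * Complex.I) *
        G ((2 * Real.pi * l * t : ℝ) * Complex.I))) := by
  -- Replacing `ε` by `max ε 0` keeps the argument of `G` in the closed half-plane, so the integrand
  -- is jointly continuous for all real `ε`.
  let f : ℝ → ℝ → ℂ := fun ε t => φ t * Complex.exp (2 * Real.pi * l * y * t * Complex.I) *
        G (((max ε 0 : ℝ) : ℂ) + (2 * Real.pi * l * t : ℝ) * Complex.I)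
  have hf : Continuous f.uncurry := by
    refine Continuous.mul (by fun_prop) ?_
    refine hG.comp_continuous (by fun_prop) fun p => ?_
    simp
  have hc := continuous_parametric_integral_of_continuous (μ := volume) hf hφs.isCompact
  have hfull : ∀ ε, ∫ t in tsupport φ, f ε t = ∫ t, f ε t := fun ε =>
    setIntegral_eq_integral_of_forall_compl_eq_zero fun t ht => by
      simp [f, image_eq_zero_of_notMem_tsupport ht]
  simp_rw [hfull] at hc
  have h0 := (hc.tendsto 0).mono_left (nhdsWithin_le_nhds (s := Ioi 0))
  have e0 : ∫ t, f 0 t = ∫ t : ℝ, φ t * Complex.exp (2 * Real.pi * l * y * t * Complex.I) *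
        G ((2 * Real.pi * l * t : ℝ) * Complex.I) := by
    simp [f]
  rw [e0] at h0
  refine h0.congr' ?_
  filter_upwards [self_mem_nhdsWithin] with ε hε
  simp only [f, max_eq_left (le_of_lt (mem_Ioi.mp hε))]

/-- Riemann-Lebesgue at frequency `-l y`. No integrability is required, since integrals of
non-integrable functions are zero by convention. -/
theorem tendsto_integral_boundary_atTop (φ : ℝ → ℂ) (G : ℂ → ℂ) {l : ℝ} (hl : 0 < l) :
    Tendsto (fun y : ℝ => ∫ t : ℝ, φ t * Complex.exp (2 * Real.pi * l * y * t * Complex.I) *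
        G ((2 * Real.pi * l * t : ℝ) * Complex.I)) atTop (𝓝 0) := by
  have h := Real.zero_at_infty_fourier
    (fun t : ℝ => φ t * G ((2 * Real.pi * l * t : ℝ) * Complex.I))
  have h1 : Tendsto (fun y : ℝ => -l * y) atTop (cocompact ℝ) :=
    (tendsto_id.const_mul_atTop_of_neg (neg_neg_of_pos hl)).mono_right atBot_le_cocompact
  refine (h.comp h1).congr fun y => ?_
  simp only [Function.comp, Real.fourier_real_eq_integral_exp_smul]
  congr 1
  ext t
  rw [smul_eq_mul, mul_comm, mul_right_comm]
  congr 3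
  push_cast
  ring

/-! ### The polynomial main term -/

/-- The polynomial whose Laplace transform is `∑ γ_j / s ^ (j + 1)`. -/
noncomputable def laplaceInvPoly (M : ℕ) (γ : ℕ → ℂ) (x : ℝ) : ℂ :=
  ∑ j ∈ Finset.range (M + 1), γ j / (j.factorial : ℂ) * (x : ℂ) ^ j

theorem continuous_laplaceInvPoly (M : ℕ) (γ : ℕ → ℂ) : Continuous (laplaceInvPoly M γ) := by
  unfold laplaceInvPoly
  fun_prop

theorem laplaceInvPoly_mul (M : ℕ) (γ : ℕ → ℂ) (s : ℂ) :
    (fun x : ℝ => laplaceInvPoly M γ x * Complex.exp (-s * x)) = fun x : ℝ =>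
      ∑ j ∈ Finset.range (M + 1),
        γ j / (j.factorial : ℂ) * ((x : ℂ) ^ j * Complex.exp (-s * x)) := by
  ext x
  simp only [laplaceInvPoly, Finset.sum_mul, mul_assoc]

theorem integrableOn_laplaceInvPoly_mul (M : ℕ) (γ : ℕ → ℂ) {s : ℂ} (hs : 0 < s.re) :
    IntegrableOn (fun x : ℝ => laplaceInvPoly M γ x * Complex.exp (-s * x)) (Ioi 0) := by
  rw [laplaceInvPoly_mul]
  exact integrable_finsetSum _ fun j _ => (integrableOn_pow_mul_cexp_neg j hs).const_mul _

theorem integral_laplaceInvPoly_mul (M : ℕ) (γ : ℕ → ℂ) {s : ℂ} (hs : 0 < s.re) :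
    ∫ x in Ioi (0 : ℝ), laplaceInvPoly M γ x * Complex.exp (-s * x) =
      ∑ j ∈ Finset.range (M + 1), γ j / s ^ (j + 1) := by
  rw [laplaceInvPoly_mul,
    integral_finsetSum _ fun j _ => (integrableOn_pow_mul_cexp_neg j hs).const_mul _]
  refine Finset.sum_congr rfl fun j _ => ?_
  rw [integral_const_mul, integral_pow_mul_cexp_neg j hs]
  have : (j.factorial : ℂ) ≠ 0 := by exact_mod_cast j.factorial_ne_zero
  field_simp

theorem exists_norm_laplaceInvPoly_le (M : ℕ) (γ : ℕ → ℂ) :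
    ∃ C, 0 ≤ C ∧ ∀ x, ‖laplaceInvPoly M γ x‖ ≤ C * (1 + |x|) ^ M := by
  refine ⟨∑ j ∈ Finset.range (M + 1), ‖γ j / (j.factorial : ℂ)‖, by positivity, fun x => ?_⟩
  rw [laplaceInvPoly, Finset.sum_mul]
  refine norm_sum_le_of_le _ fun j hj => ?_
  rw [norm_mul, norm_pow, Complex.norm_real, Real.norm_eq_abs]
  have hx := abs_nonneg x
  have h1 : |x| ^ j ≤ (1 + |x|) ^ M :=
    (pow_le_pow_left₀ hx (by linarith) j).trans
      (pow_le_pow_right₀ (by linarith) (by simpa [Nat.lt_succ_iff] using hj))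
  gcongr

/-- Since `(v + y)^j / y^M = (v/y + 1)^j y^{-(M-j)}`, only `j = M` survives. -/
theorem tendsto_laplaceInvPoly_div (M : ℕ) (γ : ℕ → ℂ) (v : ℝ) :
    Tendsto (fun y : ℝ => laplaceInvPoly M γ (v + y) / (y : ℂ) ^ M) atTop
      (𝓝 (γ M / (M.factorial : ℂ))) := by
  have hinv : Tendsto (fun y : ℝ => ((y⁻¹ : ℝ) : ℂ)) atTop (𝓝 0) := by
    have := (Complex.continuous_ofReal.tendsto 0).comp tendsto_inv_atTop_zero
    simpa [Function.comp_def] using this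
  have hq : Tendsto (fun y : ℝ => (v : ℂ) * ((y⁻¹ : ℝ) : ℂ) + 1) atTop (𝓝 1) := by
    simpa using (hinv.const_mul (v : ℂ)).add_const 1
  have hterm : ∀ j ∈ Finset.range (M + 1), Tendsto (fun y : ℝ => γ j / (j.factorial : ℂ) *
      (((v : ℂ) * ((y⁻¹ : ℝ) : ℂ) + 1) ^ j * ((y⁻¹ : ℝ) : ℂ) ^ (M - j))) atTop
      (𝓝 (if j = M then γ M / (M.factorial : ℂ) else 0)) := by
    intro j hj
    have h := ((hq.pow j).mul (hinv.pow (M - j))).const_mul (γ j / (j.factorial : ℂ))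
    convert! h using 2
    split_ifs with hjM
    · simp [hjM]
    · have : M - j ≠ 0 := by
        have := Finset.mem_range.mp hj
        omega
      simp [this]
  have h := tendsto_finsetSum _ hterm
  rw [Finset.sum_ite_eq' (Finset.range (M + 1)) M, if_pos (by simp)] at h
  refine h.congr' ?_
  filter_upwards [eventually_gt_atTop 0] with y hy
  rw [laplaceInvPoly, Finset.sum_div]
  refine Finset.sum_congr rfl fun j hj => ?_
  have hy' : (y : ℂ) ≠ 0 := by exact_mod_cast hy.ne'
  have e : (v : ℂ) * ((y⁻¹ : ℝ) : ℂ) + 1 = (v + y) / y := by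
    push_cast
    field_simp
  have hM : (y : ℂ) ^ M = (y : ℂ) ^ j * (y : ℂ) ^ (M - j) := by
    rw [← pow_add, Nat.add_sub_cancel' (Nat.lt_succ_iff.mp (Finset.mem_range.mp hj))]
  rw [e, div_pow, mul_div_assoc, hM]
  push_cast
  rw [inv_pow]
  field_simp

/-! ### Asymptotics of the kernel averages -/

section Smoothing

variable {φ : ℝ → ℂ} {K : ℝ → ℝ} {b : ℝ → ℝ} {G : ℂ → ℂ} {M : ℕ} {γ : ℕ → ℂ}

theorem integrable_laplaceInvPoly_mul_kernel (hKc : Continuous K) (hK0 : ∀ v, 0 ≤ K v)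
    (hKm : ∀ n : ℕ, Integrable fun v => |v| ^ n * K v) {l : ℝ} (hl : 0 < l) (y : ℝ) :
    Integrable fun x => laplaceInvPoly M γ x * (K (l * (x - y)) : ℂ) := by
  obtain ⟨C, hC0, hC⟩ := exists_norm_laplaceInvPoly_le M γ
  have hA := continuous_laplaceInvPoly M γ
  refine ((integrable_one_add_abs_pow_mul_comp hKc hK0 hKm hl y M).const_mul C).mono'
    (by fun_prop) (ae_of_all _ fun x => ?_)
  rw [norm_mul, Complex.norm_real, Real.norm_of_nonneg (hK0 _), ← mul_assoc]
  exact mul_le_mul_of_nonneg_right (hC x) (hK0 _)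

/-- The undamped identity, the limit `ε → 0` of the damped one. Integrability of `b` against the
kernel is not known beforehand; it comes out of monotone convergence, because the other side has a
finite limit. -/
theorem integral_mul_kernel_eq (hφ : Continuous φ) (hφs : HasCompactSupport φ)
    (hK : ∀ v, (K v : ℂ) = 𝓕 φ v) (hK0 : ∀ v, 0 ≤ K v) (hKc : Continuous K)
    (hKm : ∀ n : ℕ, Integrable fun v => |v| ^ n * K v)
    (hb0 : ∀ x, 0 < x → 0 ≤ b x)
    (hbi : ∀ ε : ℝ, 0 < ε → IntegrableOn (fun x => b x * Real.exp (-ε * x)) (Ioi 0))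
    (hG : ContinuousOn G {s : ℂ | 0 ≤ s.re})
    (hlap : ∀ s : ℂ, 0 < s.re → ∫ x in Ioi (0 : ℝ), (b x : ℂ) * Complex.exp (-s * x) =
      ∑ j ∈ Finset.range (M + 1), γ j / s ^ (j + 1) + G s) {l : ℝ} (hl : 0 < l) (y : ℝ) :
    IntegrableOn (fun x => b x * K (l * (x - y))) (Ioi 0) ∧
      ((∫ x in Ioi (0 : ℝ), b x * K (l * (x - y)) : ℝ) : ℂ) =
        (∫ x in Ioi (0 : ℝ), laplaceInvPoly M γ x * (K (l * (x - y)) : ℂ)) +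
        ∫ t : ℝ, φ t * Complex.exp (2 * Real.pi * l * y * t * Complex.I) *
          G ((2 * Real.pi * l * t : ℝ) * Complex.I) := by
  obtain ⟨B, hB⟩ : ∃ B, ∀ v, K v ≤ B := by
    refine ⟨∫ x, ‖φ x‖, fun v => ?_⟩
    rw [← abs_of_nonneg (hK0 v), ← Real.norm_eq_abs, ← Complex.norm_real, hK]
    exact VectorFourier.norm_fourierIntegral_le_integral_norm _ _ _ _ _
  have hKb : ∀ x, ‖(K (l * (x - y)) : ℂ)‖ ≤ B := fun x => by
    rw [Complex.norm_real, Real.norm_of_nonneg (hK0 _)]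
    exact hB _
  have hbC : ∀ s : ℂ, 0 < s.re →
      IntegrableOn (fun x : ℝ => (b x : ℂ) * Complex.exp (-s * x)) (Ioi 0) := by
    intro s hs
    have h1 := (hbi s.re hs).ofReal (𝕜 := ℂ)
    have h2 := h1.mul_bdd (c := 1) (g := fun x : ℝ => Complex.exp ((-s.im * x : ℝ) * Complex.I))
      (Continuous.aestronglyMeasurable (by fun_prop))
      (ae_of_all _ fun x => (Complex.norm_exp_ofReal_mul_I _).le)
    refine h2.congr (ae_of_all _ fun x => ?_)
    simp only [Complex.coe_algebraMap]
    push_cast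
    rw [mul_assoc, ← Complex.exp_add]
    congr 2
    conv_rhs => rw [← Complex.re_add_im s]
    ring
  -- The difference `b - A` has Laplace transform exactly `G`, the polar terms having cancelled.
  have key : ∀ ε : ℝ, 0 < ε →
      ((∫ x in Ioi (0 : ℝ), b x * Real.exp (-ε * x) * K (l * (x - y)) : ℝ) : ℂ) =
      (∫ x in Ioi (0 : ℝ), laplaceInvPoly M γ x * Complex.exp (-(ε : ℂ) * x) *
        (K (l * (x - y)) : ℂ)) +
      ∫ t : ℝ, φ t * Complex.exp (2 * Real.pi * l * y * t * Complex.I) *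
        G ((ε : ℂ) + (2 * Real.pi * l * t : ℝ) * Complex.I) := by
    intro ε hε
    have i1 := hbC ε (by simpa using hε)
    have i2 := integrableOn_laplaceInvPoly_mul M γ (s := ε) (by simpa using hε)
    have h := integral_mul_exp_mul_kernel (D := fun x => (b x : ℂ) - laplaceInvPoly M γ x)
      (ε := ε) hφ hφs hK l y (by simpa only [sub_mul, Pi.sub_def] using i1.sub i2)
    have hr : ∀ t : ℝ, ∫ x in Ioi (0 : ℝ), ((b x : ℂ) - laplaceInvPoly M γ x) *
        Complex.exp (-((ε : ℂ) + (2 * Real.pi * l * t : ℝ) * Complex.I) * x) =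
        G ((ε : ℂ) + (2 * Real.pi * l * t : ℝ) * Complex.I) := by
      intro t
      have hre : 0 < ((ε : ℂ) + (2 * Real.pi * l * t : ℝ) * Complex.I).re := by
        simpa using hε
      simp_rw [sub_mul]
      rw [integral_sub (hbC _ hre) (integrableOn_laplaceInvPoly_mul M γ hre), hlap _ hre,
        integral_laplaceInvPoly_mul M γ hre]
      ring
    simp_rw [hr, sub_mul] at h
    have hm : AEStronglyMeasurable (fun x : ℝ => (K (l * (x - y)) : ℂ))
        (volume.restrict (Ioi 0)) := Continuous.aestronglyMeasurable (by fun_prop)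
    rw [integral_sub (i1.mul_bdd hm (ae_of_all _ hKb)) (i2.mul_bdd hm (ae_of_all _ hKb)),
      sub_eq_iff_eq_add'] at h
    rw [← h, ← integral_complex_ofReal]
    congr 1
    ext x
    push_cast
    rfl
  have hA : Tendsto (fun ε : ℝ => ∫ x in Ioi (0 : ℝ), laplaceInvPoly M γ x *
      Complex.exp (-(ε : ℂ) * x) * (K (l * (x - y)) : ℂ)) (𝓝[>] 0)
      (𝓝 (∫ x in Ioi (0 : ℝ), laplaceInvPoly M γ x * (K (l * (x - y)) : ℂ))) := by
    have hAc := continuous_laplaceInvPoly M γ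
    refine tendsto_integral_filter_of_dominated_convergence
      (fun x => ‖laplaceInvPoly M γ x * (K (l * (x - y)) : ℂ)‖)
      (Eventually.of_forall fun ε => Continuous.aestronglyMeasurable (by fun_prop)) ?_
      (integrable_laplaceInvPoly_mul_kernel hKc hK0 hKm hl y).integrableOn.norm ?_
    · filter_upwards [self_mem_nhdsWithin] with ε hε
      filter_upwards [ae_restrict_mem measurableSet_Ioi] with x hx
      have : Real.exp (-ε * x) ≤ 1 := by
        rw [Real.exp_le_one_iff, neg_mul]
        exact neg_nonpos.mpr (mul_pos hε hx).le
      have hn : ‖Complex.exp (-(ε : ℂ) * x)‖ ≤ 1 := by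
        rw [Complex.norm_exp]
        simpa using this
      rw [mul_right_comm, norm_mul]
      exact mul_le_of_le_one_right (norm_nonneg _) hn
    · refine ae_of_all _ fun x => ?_
      have hc : Continuous fun ε : ℝ => laplaceInvPoly M γ x *
        Complex.exp (-(ε : ℂ) * x) * (K (l * (x - y)) : ℂ) := by fun_prop
      have := (hc.tendsto 0).mono_left (nhdsWithin_le_nhds (s := Ioi 0))
      simpa using this
  have hlim := hA.add (tendsto_integral_mul_boundary hφ hφs hG l y)
  set R : ℂ := (∫ x in Ioi (0 : ℝ), laplaceInvPoly M γ x * (K (l * (x - y)) : ℂ)) +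
        ∫ t : ℝ, φ t * Complex.exp (2 * Real.pi * l * y * t * Complex.I) *
          G ((2 * Real.pi * l * t : ℝ) * Complex.I) with hR
  have hlimR : Tendsto (fun ε : ℝ => ((∫ x in Ioi (0 : ℝ), b x * Real.exp (-ε * x) *
      K (l * (x - y)) : ℝ) : ℂ)) (𝓝[>] 0) (𝓝 R) := by
    refine hlim.congr' ?_
    filter_upwards [self_mem_nhdsWithin] with ε hε
    exact (key ε hε).symm
  have hre := (Complex.continuous_re.tendsto R).comp hlimR
  have him := (Complex.continuous_im.tendsto R).comp hlimR
  simp only [Function.comp_def, Complex.ofReal_re, Complex.ofReal_im] at hre him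
  have him0 : R.im = 0 := (tendsto_nhds_unique him tendsto_const_nhds)
  -- Along `ε = 1/(n+1)` the damped integrands increase with `n`.
  have hseq : Tendsto (fun n : ℕ => (1 / ((n : ℝ) + 1))) atTop (𝓝[>] 0) :=
    tendsto_nhdsWithin_iff.mpr ⟨tendsto_one_div_add_atTop_nhds_zero_nat,
      Eventually.of_forall fun n => mem_Ioi.mpr Nat.one_div_pos_of_nat⟩
  have hmct := integrable_and_integral_eq_of_monotone_tendsto
    (μ := volume.restrict (Ioi (0 : ℝ)))
    (f := fun n x => b x * Real.exp (-(1 / ((n : ℝ) + 1)) * x) * K (l * (x - y)))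
    (g := fun x => b x * K (l * (x - y))) (L := R.re) ?_ ?_ ?_ ?_ (hre.comp hseq)
  · refine ⟨hmct.1, ?_⟩
    rw [hmct.2]
    apply Complex.ext <;> simp [him0]
  · intro n
    refine (hbi _ Nat.one_div_pos_of_nat).mul_bdd (c := B) (by fun_prop)
      (ae_of_all _ fun x => ?_)
    rw [Real.norm_of_nonneg (hK0 _)]
    exact hB _
  · intro n
    filter_upwards [ae_restrict_mem measurableSet_Ioi] with x hx
    exact mul_nonneg (mul_nonneg (hb0 x hx) (Real.exp_pos _).le) (hK0 _)
  · filter_upwards [ae_restrict_mem measurableSet_Ioi] with x hx m n hmn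
    have h1 := Nat.one_div_le_one_div (α := ℝ) hmn
    have hx : 0 < x := hx
    have h2 := hb0 x hx
    have h3 := hK0 (l * (x - y))
    dsimp only
    gcongr
  · refine ae_of_all _ fun x => ?_
    have hc : Continuous fun ε : ℝ => b x * Real.exp (-ε * x) * K (l * (x - y)) := by fun_prop
    have := (hc.tendsto 0).comp tendsto_one_div_add_atTop_nhds_zero_nat
    simpa [Function.comp_def] using this

theorem tendsto_integral_laplaceInvPoly_mul_kernel (hKc : Continuous K) (hK0 : ∀ v, 0 ≤ K v)
    (hKm : ∀ n : ℕ, Integrable fun v => |v| ^ n * K v) {l : ℝ} (hl : 0 < l) :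
    Tendsto (fun y : ℝ => (∫ x in Ioi (0 : ℝ), laplaceInvPoly M γ x * (K (l * (x - y)) : ℂ)) /
      (y : ℂ) ^ M) atTop (𝓝 (γ M / (M.factorial : ℂ) * ((l⁻¹ * ∫ v, K v : ℝ) : ℂ))) := by
  obtain ⟨C, hC0, hC⟩ := exists_norm_laplaceInvPoly_le M γ
  have hA := continuous_laplaceInvPoly M γ
  have hshift : ∀ y : ℝ, (∫ x in Ioi (0 : ℝ), laplaceInvPoly M γ x * (K (l * (x - y)) : ℂ)) /
      (y : ℂ) ^ M = ∫ v, (Ioi (-y)).indicator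
        (fun v => laplaceInvPoly M γ (v + y) / (y : ℂ) ^ M * (K (l * v) : ℂ)) v := by
    intro y
    rw [← integral_indicator measurableSet_Ioi, ← integral_add_right_eq_self _ y,
      ← integral_div]
    congr 1
    ext v
    by_cases hv : -y < v
    · have hv' : 0 < v + y := by linarith
      simp only [indicator, mem_Ioi, hv, hv', if_true, add_sub_cancel_right]
      ring
    · have hv' : ¬ 0 < v + y := by linarith
      simp [indicator, hv, hv']
  have hconst : γ M / (M.factorial : ℂ) * ((l⁻¹ * ∫ v, K v : ℝ) : ℂ) =
      ∫ v, γ M / (M.factorial : ℂ) * (K (l * v) : ℂ) := by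
    rw [integral_const_mul, integral_complex_ofReal, Measure.integral_comp_mul_left]
    simp [abs_of_pos hl]
  simp_rw [hshift]
  rw [hconst]
  -- For `y ≥ 1`, `1 + |v + y| ≤ y (2 + |v|)`; dividing by `y^M` leaves a bound independent of `y`.
  refine tendsto_integral_filter_of_dominated_convergence
    (fun v => C * ((2 + l⁻¹ * |l * v|) ^ M * K (l * v))) ?_ ?_ ?_ ?_
  · refine Eventually.of_forall fun y => ?_
    exact (Continuous.aestronglyMeasurable (by fun_prop)).indicator measurableSet_Ioi
  · filter_upwards [eventually_ge_atTop 1] with y hy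
    refine ae_of_all _ fun v => (norm_indicator_le_norm_self _ _).trans ?_
    have hy0 : 0 < y := by linarith
    rw [norm_mul, Complex.norm_real, Real.norm_of_nonneg (hK0 _), ← mul_assoc]
    refine mul_le_mul_of_nonneg_right ?_ (hK0 _)
    rw [norm_div, norm_pow, Complex.norm_real, Real.norm_of_nonneg hy0.le, div_le_iff₀ (by positivity),
      mul_assoc, ← mul_pow, abs_mul, abs_of_pos hl, inv_mul_cancel_left₀ hl.ne']
    refine (hC _).trans (mul_le_mul_of_nonneg_left (pow_le_pow_left₀ (by positivity) ?_ _) hC0)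
    have := abs_add_le v y
    rw [abs_of_pos hy0] at this
    nlinarith [abs_nonneg v]
  · exact ((integrable_add_mul_abs_pow_mul hKm 2 l⁻¹ M).comp_mul_left' hl.ne').const_mul C
  · refine ae_of_all _ fun v => ?_
    refine ((tendsto_laplaceInvPoly_div M γ v).mul_const (K (l * v) : ℂ)).congr' ?_
    filter_upwards [eventually_gt_atTop (-v)] with y hy
    have hv : -y < v := by linarith
    simp [indicator, hv]

theorem tendsto_integral_mul_kernel (hφ : Continuous φ) (hφs : HasCompactSupport φ)
    (hK : ∀ v, (K v : ℂ) = 𝓕 φ v) (hK0 : ∀ v, 0 ≤ K v) (hKc : Continuous K)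
    (hKm : ∀ n : ℕ, Integrable fun v => |v| ^ n * K v)
    (hb0 : ∀ x, 0 < x → 0 ≤ b x)
    (hbi : ∀ ε : ℝ, 0 < ε → IntegrableOn (fun x => b x * Real.exp (-ε * x)) (Ioi 0))
    (hG : ContinuousOn G {s : ℂ | 0 ≤ s.re})
    (hlap : ∀ s : ℂ, 0 < s.re → ∫ x in Ioi (0 : ℝ), (b x : ℂ) * Complex.exp (-s * x) =
      ∑ j ∈ Finset.range (M + 1), γ j / s ^ (j + 1) + G s) {l : ℝ} (hl : 0 < l) :
    Tendsto (fun y : ℝ => (((∫ x in Ioi (0 : ℝ), b x * K (l * (x - y))) / y ^ M : ℝ) : ℂ)) atTop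
      (𝓝 (γ M / (M.factorial : ℂ) * ((l⁻¹ * ∫ v, K v : ℝ) : ℂ))) := by
  have h1 := tendsto_integral_laplaceInvPoly_mul_kernel (M := M) (γ := γ) hKc hK0 hKm hl
  have h2 : Tendsto (fun y : ℝ => (∫ t : ℝ, φ t * Complex.exp (2 * Real.pi * l * y * t *
      Complex.I) * G ((2 * Real.pi * l * t : ℝ) * Complex.I)) / (y : ℂ) ^ M) atTop (𝓝 0) := by
    refine squeeze_zero_norm' ?_ (tendsto_zero_iff_norm_tendsto_zero.mp
      (tendsto_integral_boundary_atTop φ G hl))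
    filter_upwards [eventually_ge_atTop 1] with y hy
    rw [norm_div, norm_pow, Complex.norm_real, Real.norm_of_nonneg (by linarith)]
    exact div_le_self (norm_nonneg _) (one_le_pow₀ hy)
  have h := h1.add h2
  rw [add_zero] at h
  refine h.congr fun y => ?_
  rw [← add_div, ← (integral_mul_kernel_eq hφ hφs hK hK0 hKc hKm hb0 hbi hG hlap hl y).2]
  push_cast
  rfl

end Smoothing

/-! ### Tauberian argument: from averages to pointwise values -/

theorem tendsto_integral_indicator_abs_gt {g : ℝ → ℝ} (hg : Integrable g) :
    Tendsto (fun r : ℝ => ∫ w, {w : ℝ | r < |w|}.indicator g w) atTop (𝓝 0) := by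
  have hm : ∀ r : ℝ, MeasurableSet {w : ℝ | r < |w|} := fun r =>
    measurableSet_lt measurable_const measurable_id.abs
  have h := tendsto_integral_filter_of_dominated_convergence (l := atTop)
    (F := fun (r : ℝ) w => {w : ℝ | r < |w|}.indicator g w) (f := fun _ => (0 : ℝ))
    (fun w => ‖g w‖) (μ := volume)
    (Eventually.of_forall fun r => hg.aestronglyMeasurable.indicator (hm r))
    (Eventually.of_forall fun r => ae_of_all _ fun w => norm_indicator_le_norm_self _ _)
    hg.norm (ae_of_all _ fun w => ?_)
  · simpa using h
  · refine tendsto_const_nhds.congr' ?_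
    filter_upwards [eventually_ge_atTop |w|] with r hr
    simp [hr]

theorem integral_comp_mul_sub (g : ℝ → ℝ) {l : ℝ} (hl : 0 < l) (z : ℝ) :
    ∫ x, g (l * (x - z)) = l⁻¹ * ∫ w, g w := by
  rw [integral_sub_right_eq_self (fun x => g (l * x)) z, Measure.integral_comp_mul_left,
    abs_of_pos (inv_pos.mpr hl), smul_eq_mul]

section Tauberian

variable {b K : ℝ → ℝ} {M : ℕ} {c : ℝ}

/-- Centring at `y + δ` places the window `|l(x - (y + δ))| ≤ lδ` on `[y, y + 2δ]`, where `b x ≥ b y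
e^{y-x} ≥ b y e^{-2δ}`. The rest of the average is non-negative and is dropped. -/
theorem mul_integral_kernel_le (hK0 : ∀ v, 0 ≤ K v) (hKi : Integrable K)
    (hb0 : ∀ x, 0 < x → 0 ≤ b x)
    (hmono : ∀ x y, 0 < x → x ≤ y → b x * Real.exp x ≤ b y * Real.exp y)
    {l δ y : ℝ} (hl : 0 < l) (hy : 0 < y)
    (hint : IntegrableOn (fun x => b x * K (l * (x - (y + δ)))) (Ioi 0)) :
    b y * Real.exp (-(2 * δ)) *
      (l⁻¹ * ((∫ w, K w) - ∫ w, {w : ℝ | l * δ < |w|}.indicator K w)) ≤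
      ∫ x in Ioi (0 : ℝ), b x * K (l * (x - (y + δ))) := by
  have hm : MeasurableSet {w : ℝ | l * δ < |w|} :=
    measurableSet_lt measurable_const measurable_id.abs
  have hh : Integrable fun w => K w - {w : ℝ | l * δ < |w|}.indicator K w :=
    hKi.sub (hKi.indicator hm)
  have hsupp : ∀ x, |l * (x - (y + δ))| ≤ l * δ → y ≤ x ∧ x ≤ y + 2 * δ := by
    intro x hx
    rw [abs_mul, abs_of_pos hl, mul_le_mul_iff_right₀ hl, abs_le] at hx
    constructor <;> linarith [hx.1, hx.2]
  rw [← integral_sub hKi (hKi.indicator hm),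
    ← integral_comp_mul_sub (fun w => K w - {w : ℝ | l * δ < |w|}.indicator K w) hl (y + δ),
    ← integral_const_mul,
    ← setIntegral_eq_integral_of_forall_compl_eq_zero (s := Ioi (0 : ℝ))]
  · refine setIntegral_mono_on
      (((hh.comp_mul_left' hl.ne').comp_sub_right (y + δ)).const_mul _).integrableOn hint
      measurableSet_Ioi fun x hx => ?_
    by_cases hw : l * δ < |l * (x - (y + δ))|
    · simp only [indicator, mem_ofPred_eq, hw, if_true, sub_self, mul_zero]
      exact mul_nonneg (hb0 x hx) (hK0 _)
    · obtain ⟨h1, h2⟩ := hsupp x (not_lt.mp hw)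
      simp only [indicator, mem_ofPred_eq, hw, if_false, sub_zero]
      refine mul_le_mul_of_nonneg_right ?_ (hK0 _)
      have h3 := hmono y x hy h1
      calc b y * Real.exp (-(2 * δ)) ≤ b y * Real.exp (y - x) := by
            gcongr
            · exact hb0 y hy
            · linarith
        _ = b y * Real.exp y * Real.exp (-x) := by
            rw [mul_assoc, ← Real.exp_add, sub_eq_add_neg]
        _ ≤ b x * Real.exp x * Real.exp (-x) := by gcongr
        _ = b x := by rw [mul_assoc, ← Real.exp_add]; simp
  · intro x hx
    have hw : l * δ < |l * (x - (y + δ))| := by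
      by_contra hw
      have := (hsupp x (not_lt.mp hw)).1
      exact hx (lt_of_lt_of_le hy this)
    simp only [indicator, mem_ofPred_eq, hw, if_true, sub_self, mul_zero]

/-- Now the window is `[y - 2δ, y]`, where `b x ≤ b y e^{2δ}`. Outside it the growth bound applies,
with `1 + x ≤ y (2 + |l(x - (y - δ))|)` because `l, y ≥ 1`. -/
theorem integral_mul_kernel_le (hK0 : ∀ v, 0 ≤ K v) (hKi : Integrable K)
    (hKM : Integrable fun v => (2 + |v|) ^ M * K v)
    (hb0 : ∀ x, 0 < x → 0 ≤ b x)
    (hmono : ∀ x y, 0 < x → x ≤ y → b x * Real.exp x ≤ b y * Real.exp y)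
    {C : ℝ} (hC : ∀ x, 0 < x → b x ≤ C * (1 + x) ^ M)
    {l δ y : ℝ} (hl : 1 ≤ l) (hδ : 0 < δ) (hy : 1 ≤ y)
    (hint : IntegrableOn (fun x => b x * K (l * (x - (y - δ)))) (Ioi 0)) :
    ∫ x in Ioi (0 : ℝ), b x * K (l * (x - (y - δ))) ≤
      b y * Real.exp (2 * δ) * (l⁻¹ * ∫ w, K w) + C * y ^ M *
        (l⁻¹ * ∫ w, {w : ℝ | l * δ < |w|}.indicator (fun v => (2 + |v|) ^ M * K v) w) := by
  have hl0 : 0 < l := by linarith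
  have hy0 : 0 < y := by linarith
  have hby := hb0 y hy0
  have hC0 : 0 ≤ C := by
    have h1 : 0 ≤ C * (1 + y) ^ M := hby.trans (hC y hy0)
    exact nonneg_of_mul_nonneg_left h1 (by positivity)
  have hm : MeasurableSet {w : ℝ | l * δ < |w|} :=
    measurableSet_lt measurable_const measurable_id.abs
  set g : ℝ → ℝ := {w : ℝ | l * δ < |w|}.indicator (fun v => (2 + |v|) ^ M * K v) with hg
  have hgi : Integrable g := hKM.indicator hm
  have hg0 : ∀ w, 0 ≤ g w := fun w =>
    indicator_nonneg (fun v _ => mul_nonneg (by positivity) (hK0 v)) w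
  have i1 := ((hKi.comp_mul_left' hl0.ne').comp_sub_right (y - δ)).const_mul
    (b y * Real.exp (2 * δ))
  have i2 := ((hgi.comp_mul_left' hl0.ne').comp_sub_right (y - δ)).const_mul (C * y ^ M)
  rw [← integral_comp_mul_sub K hl0 (y - δ), ← integral_comp_mul_sub g hl0 (y - δ),
    ← integral_const_mul, ← integral_const_mul, ← integral_add i1 i2]
  refine (setIntegral_mono_on hint (i1.add i2).integrableOn measurableSet_Ioi fun x hx => ?_).trans
    (setIntegral_le_integral (i1.add i2) (ae_of_all _ fun x => ?_))
  · have hx : 0 < x := hx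
    have hk := hK0 (l * (x - (y - δ)))
    by_cases hw : l * δ < |l * (x - (y - δ))|
    · have hgw : g (l * (x - (y - δ))) =
          (2 + |l * (x - (y - δ))|) ^ M * K (l * (x - (y - δ))) := by
        simp only [hg, indicator, mem_ofPred_eq, hw, if_true]
      have hle : 1 + x ≤ y * (2 + |l * (x - (y - δ))|) := by
        have h1 : |x - (y - δ)| ≤ |l * (x - (y - δ))| := by
          rw [abs_mul, abs_of_pos hl0]
          exact le_mul_of_one_le_left (abs_nonneg _) hl
        have h2 := le_abs_self (x - (y - δ))
        nlinarith [abs_nonneg (x - (y - δ))]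
      have hbx : b x ≤ C * y ^ M * (2 + |l * (x - (y - δ))|) ^ M := by
        refine (hC x hx).trans ?_
        rw [mul_assoc, ← mul_pow]
        gcongr
      dsimp only [Pi.add_apply]
      rw [hgw, ← mul_assoc (C * y ^ M)]
      have h4 := mul_le_mul_of_nonneg_right hbx hk
      have h5 : 0 ≤ b y * Real.exp (2 * δ) * K (l * (x - (y - δ))) := by positivity
      linarith
    · have hgw := hg0 (l * (x - (y - δ)))
      have hxy : |x - (y - δ)| ≤ δ := by
        rwa [not_lt, abs_mul, abs_of_pos hl0, mul_le_mul_iff_right₀ hl0] at hw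
      rw [abs_le] at hxy
      have h3 := hmono x y hx (by linarith [hxy.2])
      have hbx : b x ≤ b y * Real.exp (2 * δ) := by
        calc b x = b x * Real.exp x * Real.exp (-x) := by rw [mul_assoc, ← Real.exp_add]; simp
          _ ≤ b y * Real.exp y * Real.exp (-x) := by gcongr
          _ = b y * Real.exp (y - x) := by rw [mul_assoc, ← Real.exp_add, sub_eq_add_neg]
          _ ≤ b y * Real.exp (2 * δ) := by
              gcongr
              linarith [hxy.1]
      have h4 := mul_le_mul_of_nonneg_right hbx hk
      have h5 : 0 ≤ C * y ^ M * g (l * (x - (y - δ))) := by positivity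
      dsimp only [Pi.add_apply]
      linarith
  · have hk := hK0 (l * (x - (y - δ)))
    have hgw := hg0 (l * (x - (y - δ)))
    dsimp only [Pi.add_apply, Pi.zero_apply]
    positivity

theorem tendsto_shift_div_pow {f : ℝ → ℝ} {L : ℝ} (hf : Tendsto (fun y => f y / y ^ M) atTop (𝓝 L))
    (d : ℝ) : Tendsto (fun y => f (y + d) / y ^ M) atTop (𝓝 L) := by
  have h1 := hf.comp (tendsto_atTop_add_const_right atTop d tendsto_id)
  have h2 : Tendsto (fun y : ℝ => (1 + d * y⁻¹) ^ M) atTop (𝓝 1) := by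
    simpa using ((tendsto_inv_atTop_zero.const_mul d).const_add 1).pow M
  have h3 := h1.mul h2
  rw [mul_one] at h3
  refine h3.congr' ?_
  filter_upwards [eventually_gt_atTop 0, eventually_gt_atTop (-d)] with y hy hyd
  have hyd' : y + d ≠ 0 := by linarith
  have e : 1 + d * y⁻¹ = (y + d) / y := by field_simp
  simp only [Function.comp, id]
  rw [e, div_pow]
  field_simp

variable (hK0 : ∀ v, 0 ≤ K v) (hKm : ∀ n : ℕ, Integrable fun v => |v| ^ n * K v)
  (hKpos : 0 < ∫ v, K v) (hb0 : ∀ x, 0 < x → 0 ≤ b x)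
  (hmono : ∀ x y, 0 < x → x ≤ y → b x * Real.exp x ≤ b y * Real.exp y)
  (hint : ∀ l, 0 < l → ∀ y, IntegrableOn (fun x => b x * K (l * (x - y))) (Ioi 0))
  (hlim : ∀ l, 0 < l → Tendsto (fun y => (∫ x in Ioi (0 : ℝ), b x * K (l * (x - y))) / y ^ M) atTop
    (𝓝 (c * (l⁻¹ * ∫ v, K v))))

include hK0 hKm hKpos hb0 hmono hint hlim

/-- Take `l = r^2` and `δ = 1/r`: then `δ → 0` while `lδ = r → ∞`, so both the factor `e^{2δ}` and
the lost tail become negligible. Fix a large `r`, and only then let `y → ∞`. -/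
theorem eventually_div_pow_lt {a : ℝ} (ha : c < a) : ∀ᶠ y in atTop, b y / y ^ M < a := by
  have hKi : Integrable K := by simpa using hKm 0
  set I := ∫ v, K v with hI
  have hQ : Tendsto (fun r : ℝ => Real.exp (2 * r⁻¹) * (c * I) /
      (I - ∫ w, {w : ℝ | r < |w|}.indicator K w)) atTop (𝓝 c) := by
    have h1 : Tendsto (fun r : ℝ => Real.exp (2 * r⁻¹)) atTop (𝓝 1) := by
      have := (Real.continuous_exp.tendsto _).comp (tendsto_inv_atTop_zero.const_mul (2 : ℝ))
      simpa [Function.comp_def] using this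
    have h2 := (tendsto_integral_indicator_abs_gt hKi).const_sub I
    have h3 := (h1.mul_const (c * I)).div h2 (by simpa using hKpos.ne')
    convert! h3 using 2
    rw [sub_zero, one_mul, mul_div_cancel_right₀ _ hKpos.ne']
  have hden : ∀ᶠ r : ℝ in atTop, 0 < I - ∫ w, {w : ℝ | r < |w|}.indicator K w := by
    refine ((tendsto_integral_indicator_abs_gt hKi).const_sub I).eventually_const_lt ?_
    simpa using hKpos
  obtain ⟨r, hra, hrd, hr0⟩ :=
    ((hQ.eventually_lt_const ha).and (hden.and (eventually_gt_atTop 0))).exists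
  have hl : 0 < r ^ 2 := by positivity
  have hlδ : r ^ 2 * r⁻¹ = r := by field_simp
  set κ := I - ∫ w, {w : ℝ | r < |w|}.indicator K w with hκ
  have hs := tendsto_shift_div_pow (hlim (r ^ 2) hl) r⁻¹
  have hs2 := hs.const_mul (Real.exp (2 * r⁻¹) * r ^ 2 / κ)
  have hval : Real.exp (2 * r⁻¹) * r ^ 2 / κ * (c * ((r ^ 2)⁻¹ * I)) =
      Real.exp (2 * r⁻¹) * (c * I) / κ := by
    field_simp
  rw [hval] at hs2
  filter_upwards [hs2.eventually_lt_const hra, eventually_gt_atTop 0] with y hy hy0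
  refine lt_of_le_of_lt ?_ hy
  have h := mul_integral_kernel_le hK0 hKi hb0 hmono (δ := r⁻¹) hl hy0 (hint _ hl _)
  rw [hlδ, ← hI, ← hκ] at h
  rw [← mul_div_assoc]
  gcongr
  have h4 := mul_le_mul_of_nonneg_left h
    (by positivity : 0 ≤ Real.exp (2 * r⁻¹) * r ^ 2 / κ)
  refine le_trans (le_of_eq ?_) h4
  rw [Real.exp_neg]
  field_simp

theorem exists_le_mul_one_add_pow : ∃ C, ∀ x, 0 < x → b x ≤ C * (1 + x) ^ M := by
  obtain ⟨x₀, hx₀⟩ := eventually_atTop.mp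
    (eventually_div_pow_lt hK0 hKm hKpos hb0 hmono hint hlim (lt_add_one c))
  set z := max x₀ 1 with hz
  have hz0 : 0 < z := lt_of_lt_of_le one_pos (le_max_right _ _)
  have hbz := hb0 z hz0
  -- Beyond `z` the eventual bound gives `c + 1`; on `(0, z]`, `b x ≤ b x e^x ≤ b z e^z`.
  refine ⟨max (c + 1) (b z * Real.exp z), fun x hx => ?_⟩
  rcases le_total z x with hzx | hxz
  · have h := (hx₀ x ((le_max_left _ _).trans hzx)).le
    rw [div_le_iff₀ (by positivity)] at h
    refine h.trans (mul_le_mul (le_max_left _ _) ?_ (by positivity) (by positivity))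
    exact pow_le_pow_left₀ hx.le (by linarith) _
  · have h1 : b x ≤ b x * Real.exp x :=
      le_mul_of_one_le_right (hb0 x hx) (Real.one_le_exp hx.le)
    have h2 : (1 : ℝ) ≤ (1 + x) ^ M := one_le_pow₀ (by linarith)
    calc b x ≤ b z * Real.exp z := h1.trans (hmono x z hx hxz)
      _ ≤ max (c + 1) (b z * Real.exp z) := le_max_right _ _
      _ ≤ _ := le_mul_of_one_le_right (by positivity) h2

/-- Same scaling `l = r^2`, `δ = 1/r`. The tail now carries the weight `(2 + |v|)^M`, and the finite
moments of `K` make it vanish as `r → ∞`. -/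
theorem eventually_lt_div_pow {a : ℝ} (ha : a < c) : ∀ᶠ y in atTop, a < b y / y ^ M := by
  have hKi : Integrable K := by simpa using hKm 0
  obtain ⟨C, hC⟩ := exists_le_mul_one_add_pow hK0 hKm hKpos hb0 hmono hint hlim
  have hKM : Integrable fun v => (2 + |v|) ^ M * K v := by
    simpa using integrable_add_mul_abs_pow_mul hKm 2 1 M
  set I := ∫ v, K v with hI
  set τ : ℝ → ℝ := fun r => ∫ w, {w : ℝ | r < |w|}.indicator (fun v => (2 + |v|) ^ M * K v) w
    with hτ
  have hQ : Tendsto (fun r : ℝ => Real.exp (-(2 * r⁻¹)) / I * (c * I - C * τ r)) atTop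
      (𝓝 c) := by
    have h1 : Tendsto (fun r : ℝ => Real.exp (-(2 * r⁻¹))) atTop (𝓝 1) := by
      have := (Real.continuous_exp.tendsto _).comp (tendsto_inv_atTop_zero.const_mul (2 : ℝ)).neg
      simpa [Function.comp_def] using this
    have h2 := ((tendsto_integral_indicator_abs_gt hKM).const_mul C).const_sub (c * I)
    have h3 := (h1.div_const I).mul h2
    convert! h3 using 2
    field_simp
    ring
  obtain ⟨r, hra, hr1⟩ :=
    ((hQ.eventually_const_lt ha).and (eventually_ge_atTop 1)).exists
  have hr0 : 0 < r := by linarith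
  have hl : 0 < r ^ 2 := by positivity
  have hl1 : 1 ≤ r ^ 2 := one_le_pow₀ hr1
  have hlδ : r ^ 2 * r⁻¹ = r := by field_simp
  have hs := tendsto_shift_div_pow (hlim (r ^ 2) hl) (-r⁻¹)
  have hs2 := ((hs.const_mul (r ^ 2)).sub_const (C * τ r)).const_mul
    (Real.exp (-(2 * r⁻¹)) / I)
  have hval : r ^ 2 * (c * ((r ^ 2)⁻¹ * I)) = c * I := by field_simp
  rw [hval] at hs2
  filter_upwards [hs2.eventually_const_lt hra, eventually_ge_atTop 1] with y hy hy1
  refine lt_of_lt_of_le hy ?_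
  have hy0 : 0 < y := by linarith
  have h := integral_mul_kernel_le hK0 hKi hKM hb0 hmono hC hl1 (inv_pos.mpr hr0) hy1 (hint _ hl _)
  rw [hlδ, ← hI] at h
  simp only [← sub_eq_add_neg]
  set J := ∫ x in Ioi (0 : ℝ), b x * K (r ^ 2 * (x - (y - r⁻¹))) with hJ
  have h5 : r ^ 2 * (J / y ^ M) - C * τ r ≤ b y / y ^ M * (Real.exp (2 * r⁻¹) * I) := by
    rw [sub_le_iff_le_add]
    have h6 := mul_le_mul_of_nonneg_left h (by positivity : 0 ≤ r ^ 2 / y ^ M)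
    refine le_trans (le_of_eq ?_) (h6.trans (le_of_eq ?_))
    · ring
    · simp only [hτ]
      field_simp
  calc _ ≤ Real.exp (-(2 * r⁻¹)) / I * (b y / y ^ M * (Real.exp (2 * r⁻¹) * I)) := by gcongr
    _ = b y / y ^ M := by
      rw [Real.exp_neg]
      field_simp

theorem tendsto_div_pow_of_smoothed : Tendsto (fun y => b y / y ^ M) atTop (𝓝 c) :=
  tendsto_order.mpr
    ⟨fun _ ha => eventually_lt_div_pow hK0 hKm hKpos hb0 hmono hint hlim ha,
      fun _ ha => eventually_div_pow_lt hK0 hKm hKpos hb0 hmono hint hlim ha⟩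

end Tauberian

/-! ### The substitution `u = e^x` -/

theorem abs_exp_smul_mul_exp_cpow (F : ℝ → ℝ) (s : ℂ) (x : ℝ) :
    |Real.exp x| • ((F (Real.exp x) : ℂ) * ((Real.exp x : ℝ) : ℂ) ^ (-(1 + s) - 1)) =
      ((Real.exp (-x) * F (Real.exp x) : ℝ) : ℂ) * Complex.exp (-s * x) := by
  have hpow : ((Real.exp x : ℝ) : ℂ) ^ (-(1 + s) - 1) =
      Complex.exp (-x) * Complex.exp (-x) * Complex.exp (-s * x) := by
    rw [Complex.cpow_def_of_ne_zero (by simp), ← Complex.ofReal_log (Real.exp_pos x).le,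
      Real.log_exp, ← Complex.exp_add, ← Complex.exp_add]
    congr 1
    ring
  have hone : Complex.exp x * Complex.exp (-x) = 1 := by simp [← Complex.exp_add]
  rw [abs_of_pos (Real.exp_pos x), Complex.real_smul, hpow]
  push_cast
  linear_combination (F (Real.exp x) * Complex.exp (-x) * Complex.exp (-s * x)) * hone

theorem exp_image_Ioi_zero : Real.exp '' Ioi 0 = Ioi 1 := by
  ext u
  constructor
  · rintro ⟨x, hx, rfl⟩
    exact Real.one_lt_exp_iff.mpr hx
  · intro hu
    exact ⟨Real.log u, Real.log_pos hu, Real.exp_log (one_pos.trans hu)⟩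

theorem integrableOn_exp_comp {F : ℝ → ℝ} {s : ℂ} (h : TransformConverges F (1 + s)) :
    IntegrableOn (fun x : ℝ => ((Real.exp (-x) * F (Real.exp x) : ℝ) : ℂ) *
      Complex.exp (-s * x)) (Ioi 0) := by
  rw [TransformConverges, ← exp_image_Ioi_zero,
    integrableOn_image_iff_integrableOn_abs_deriv_smul measurableSet_Ioi
      (fun x _ => (Real.hasDerivAt_exp x).hasDerivWithinAt) Real.exp_injective.injOn] at h
  simpa only [abs_exp_smul_mul_exp_cpow] using h

theorem transform_one_add (F : ℝ → ℝ) (s : ℂ) :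
    transform F (1 + s) = ∫ x in Ioi (0 : ℝ), ((Real.exp (-x) * F (Real.exp x) : ℝ) : ℂ) *
      Complex.exp (-s * x) := by
  rw [transform, ← exp_image_Ioi_zero,
    integral_image_eq_integral_abs_deriv_smul measurableSet_Ioi
      (fun x _ => (Real.hasDerivAt_exp x).hasDerivWithinAt) Real.exp_injective.injOn]
  simp only [abs_exp_smul_mul_exp_cpow]

theorem polarPoly_one_add_div (M : ℕ) (γ : ℕ → ℂ) {s : ℂ} (hs : s ≠ 0) :
    polarPoly M γ (1 + s) / (1 + s - 1) ^ (M + 1) =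
      ∑ j ∈ Finset.range (M + 1), γ j / s ^ (j + 1) := by
  rw [polarPoly, add_sub_cancel_left, Finset.sum_div]
  refine Finset.sum_congr rfl fun j hj => ?_
  have hM : s ^ (M + 1) = s ^ (M - j) * s ^ (j + 1) := by
    rw [← pow_add]
    congr 1
    have := Finset.mem_range.mp hj
    omega
  rw [hM]
  field_simp

theorem exp_neg_mul_const_mul_exp (a : ℝ) (s : ℂ) (x : ℝ) :
    ((Real.exp (-x) * a : ℝ) : ℂ) * Complex.exp (-s * x) =
      a * ((x : ℂ) ^ 0 * Complex.exp (-(1 + s) * x)) := by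
  have : Complex.exp (-(1 + s) * x) = Complex.exp (-x) * Complex.exp (-s * x) := by
    rw [← Complex.exp_add]
    congr 1
    ring
  rw [this]
  push_cast
  ring

/-- The limit form of the theorem in the logarithmic variable. -/
theorem exists_tendsto_exp_neg_mul {F : ℝ → ℝ} (hmono : MonotoneOn F (Ici 1))
    (hconv : ∀ s : ℂ, 1 < s.re → TransformConverges F s) {M : ℕ} {γ : ℕ → ℂ}
    (hf : HolomorphicContinuousUpToLine
      (fun s : ℂ => transform F s - polarPoly M γ s / (s - 1) ^ (M + 1))) :
    ∃ c : ℝ, γ M / (M.factorial : ℂ) = c ∧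
      Tendsto (fun y => Real.exp (-y) * (F (Real.exp y) - F 1) / y ^ M) atTop (𝓝 c) := by
  obtain ⟨φ, K, hφ, hφs, hK, hK0, hKc, hKm, hKpos⟩ := exists_fourier_nonneg_kernel
  obtain ⟨-, G₀, hG₀, hG₀f⟩ := hf
  beta_reduce at hG₀f
  -- Subtracting `F 1` makes `b` non-negative. It changes the transform by `F 1 / (1 + s)`, which is
  -- continuous on `Re s ≥ 0` and is absorbed into `G`.
  set b : ℝ → ℝ := fun x => Real.exp (-x) * (F (Real.exp x) - F 1) with hb
  have hFm : ∀ x y, 0 < x → x ≤ y → F (Real.exp x) ≤ F (Real.exp y) := fun x y hx hxy =>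
    hmono (Real.one_le_exp hx.le) (Real.one_le_exp (hx.le.trans hxy)) (Real.exp_le_exp.mpr hxy)
  have hb0 : ∀ x, 0 < x → 0 ≤ b x := fun x hx =>
    mul_nonneg (Real.exp_pos _).le (sub_nonneg.mpr
      (hmono (mem_Ici.mpr le_rfl) (Real.one_le_exp hx.le) (Real.one_le_exp hx.le)))
  have hbe : ∀ x, b x * Real.exp x = F (Real.exp x) - F 1 := fun x => by
    simp only [hb]
    rw [mul_right_comm, ← Real.exp_add, neg_add_cancel, Real.exp_zero, one_mul]
  have hbm : ∀ x y, 0 < x → x ≤ y → b x * Real.exp x ≤ b y * Real.exp y := by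
    intro x y hx hxy
    rw [hbe, hbe]
    linarith [hFm x y hx hxy]
  have hsplit : ∀ s : ℂ, (fun x : ℝ => (b x : ℂ) * Complex.exp (-s * x)) = fun x : ℝ =>
      ((Real.exp (-x) * F (Real.exp x) : ℝ) : ℂ) * Complex.exp (-s * x) -
        F 1 * ((x : ℂ) ^ 0 * Complex.exp (-(1 + s) * x)) := by
    intro s
    ext x
    rw [← exp_neg_mul_const_mul_exp, ← sub_mul, ← Complex.ofReal_sub, ← mul_sub]
  have hre1 : ∀ s : ℂ, 0 < s.re → 1 < (1 + s).re := fun s hs => by simpa using hs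
  have j1 : ∀ s : ℂ, 0 < s.re → IntegrableOn (fun x : ℝ =>
      ((Real.exp (-x) * F (Real.exp x) : ℝ) : ℂ) * Complex.exp (-s * x)) (Ioi 0) :=
    fun s hs => integrableOn_exp_comp (hconv _ (hre1 s hs))
  have j2 : ∀ s : ℂ, 0 < s.re → IntegrableOn (fun x : ℝ =>
      (F 1 : ℂ) * ((x : ℂ) ^ 0 * Complex.exp (-(1 + s) * x))) (Ioi 0) := fun s hs =>
    (integrableOn_pow_mul_cexp_neg 0 (one_pos.trans (hre1 s hs))).const_mul _
  have hbi : ∀ ε : ℝ, 0 < ε → IntegrableOn (fun x => b x * Real.exp (-ε * x)) (Ioi 0) := by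
    intro ε hε
    have hε' : 0 < (ε : ℂ).re := by simpa using hε
    have h : IntegrableOn (fun x : ℝ => (b x : ℂ) * Complex.exp (-(ε : ℂ) * x)) (Ioi 0) := by
      rw [hsplit]
      exact (j1 _ hε').sub (j2 _ hε')
    refine h.re.congr (ae_of_all _ fun x => ?_)
    have : (b x : ℂ) * Complex.exp (-(ε : ℂ) * x) = ((b x * Real.exp (-ε * x) : ℝ) : ℂ) := by
      push_cast
      rfl
    simp only [this]
    exact Complex.ofReal_re _
  have hG : ContinuousOn (fun s : ℂ => G₀ (1 + s) - F 1 / (1 + s)) {s : ℂ | 0 ≤ s.re} := by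
    refine ContinuousOn.sub ?_ ?_
    · exact hG₀.comp (by fun_prop) fun s hs => by simpa using hs
    · refine continuousOn_const.div (by fun_prop) fun s hs h0 => ?_
      have h1 := congrArg Complex.re h0
      have hs : 0 ≤ s.re := hs
      simp only [Complex.add_re, Complex.one_re, Complex.zero_re] at h1
      linarith
  have hlap : ∀ s : ℂ, 0 < s.re → ∫ x in Ioi (0 : ℝ), (b x : ℂ) * Complex.exp (-s * x) =
      ∑ j ∈ Finset.range (M + 1), γ j / s ^ (j + 1) + (G₀ (1 + s) - F 1 / (1 + s)) := by
    intro s hs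
    have hs0 : s ≠ 0 := by
      rintro rfl
      simp at hs
    rw [hsplit, integral_sub (j1 s hs) (j2 s hs), ← transform_one_add, integral_const_mul,
      integral_pow_mul_cexp_neg 0 (one_pos.trans (hre1 s hs)), hG₀f _ (hre1 s hs),
      polarPoly_one_add_div M γ hs0]
    simp
    ring
  have hlimC := fun l (hl : 0 < l) =>
    tendsto_integral_mul_kernel hφ hφs hK hK0 hKc hKm hb0 hbi hG hlap (l := l) hl
  -- The averages are real, so their limit is; as `∫ K > 0`, this forces `γ_M / M!` to be real.
  have hγ : γ M / (M.factorial : ℂ) = ((γ M / (M.factorial : ℂ)).re : ℂ) := by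
    have h := (Complex.continuous_im.tendsto _).comp (hlimC 1 one_pos)
    simp only [Function.comp_def, Complex.ofReal_im] at h
    have h0 := tendsto_nhds_unique h tendsto_const_nhds
    rw [Complex.im_mul_ofReal] at h0
    have h1 : (γ M / (M.factorial : ℂ)).im = 0 := by
      rcases mul_eq_zero.mp h0 with h0 | h0
      · exact h0
      · simp [hKpos.ne'] at h0
    apply Complex.ext <;> simp [h1]
  refine ⟨_, hγ, tendsto_div_pow_of_smoothed hK0 hKm hKpos hb0 hbm
    (fun l hl y => (integral_mul_kernel_eq hφ hφs hK hK0 hKc hKm hb0 hbi hG hlap hl y).1) ?_⟩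
  intro l hl
  have h := (Complex.continuous_re.tendsto _).comp (hlimC l hl)
  simpa only [Function.comp_def, Complex.ofReal_re, Complex.re_mul_ofReal] using h

end WienerIkehara

/-! ### Return to the variable `x` -/

theorem proposition1 (F : ℝ → ℝ) (hmono : MonotoneOn F (Set.Ici 1))
    (hcont : ContinuousOn F (Set.Ici 1))
    (hconv : ∀ s : ℂ, 1 < s.re → WienerIkehara.TransformConverges F s)
    (M : ℕ) (γ : ℕ → ℂ) (hγ : γ M ≠ 0)
    (hf : WienerIkehara.HolomorphicContinuousUpToLine
      (fun s : ℂ => WienerIkehara.transform F s -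
        WienerIkehara.polarPoly M γ s / (s - 1) ^ (M + 1))) :
    Asymptotics.IsEquivalent Filter.atTop (fun x : ℝ => (F x : ℂ))
      (fun x : ℝ => γ M / (M.factorial : ℂ) * (x : ℂ) * ((Real.log x : ℝ) : ℂ) ^ M) := by
  obtain ⟨c, hc, hlim⟩ := WienerIkehara.exists_tendsto_exp_neg_mul hmono hconv hf
  have hc0 : c ≠ 0 := by
    rintro rfl
    have hM : (M.factorial : ℂ) ≠ 0 := by exact_mod_cast M.factorial_ne_zero
    simp [hγ, hM] at hc
  have h1 := hlim.comp Real.tendsto_log_atTop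
  -- This restores the subtracted `F 1`; for `x ≥ e` the logarithmic factor is at least 1.
  have h2 : Tendsto (fun x : ℝ => F 1 / (x * Real.log x ^ M)) atTop (𝓝 0) := by
    refine squeeze_zero_norm' ?_ (tendsto_const_nhds.div_atTop tendsto_id : Tendsto
      (fun x : ℝ => ‖F 1‖ / x) atTop (𝓝 0))
    filter_upwards [eventually_ge_atTop (Real.exp 1)] with x hx
    have hx0 : 0 < x := (Real.exp_pos 1).trans_le hx
    have hlog : 1 ≤ Real.log x := (Real.le_log_iff_exp_le hx0).mpr hx
    have hp : 1 ≤ Real.log x ^ M := one_le_pow₀ hlog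
    rw [norm_div, Real.norm_of_nonneg (by positivity : 0 ≤ x * Real.log x ^ M)]
    exact div_le_div_of_nonneg_left (norm_nonneg _) hx0 (le_mul_of_one_le_right hx0.le hp)
  have h3 : Tendsto (fun x : ℝ => F x / (c * x * Real.log x ^ M)) atTop (𝓝 1) := by
    have h := (h1.add h2).div_const c
    rw [add_zero, div_self hc0] at h
    refine h.congr' ?_
    filter_upwards [eventually_gt_atTop 1] with x hx
    have hx0 : 0 < x := by linarith
    have hlog : 0 < Real.log x := Real.log_pos hx
    simp only [Function.comp, Real.exp_neg, Real.exp_log hx0]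
    field_simp
    ring
  have h4 : Tendsto (fun x : ℝ => (F x : ℂ) / (c * x * ((Real.log x : ℝ) : ℂ) ^ M)) atTop
      (𝓝 1) := by
    have := (Complex.continuous_ofReal.tendsto 1).comp h3
    simpa [Function.comp_def] using this
  rw [hc]
  exact isEquivalent_of_tendsto_one h4
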